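/- **Lemma 3.4.** Let $(X,\omega)$ be a symplectic manifold and let a Lie group $G$ with Lie algebra $\mathfrak g$ act smoothly on $X$ in a Hamiltonian way with moment map $\Phi:X\to\mathfrak g^*$; that is, the action preserves $\omega$, the map $\Phi$ is smooth and equivariant for the coadjoint action, and $d\langle\Phi,\xi\rangle=\omega(\xi_X,\cdot)$ for every $\xi\in\mathfrak g$, where $\xi_X$ is the fundamental vector field of $\xi$. Assume that $\Phi$ meets $0$ cleanly: $\Phi^{-1}(0)$ is an embedded submanifold of $X$, with inclusion $\iota$, and $T_x(\Phi^{-1}(0))=\ker d\Phi_x$ for every $x\in\Phi^{-1}(0)$. Let $\rho:\Phi^{-1}(0)\to Y=\Phi^{-1}(0)/G$ be the projection to the reduced space, i.e. $Y$, with the quotient topology, is a smooth manifold such that $\rho$ is a smooth submersion, and $Y$ carries the reduced two-form $\omega_Y$, which is determined by $\rho^*\omega_Y=\iota^*\omega$. (All manifolds are finite-dimensional, of pure dimension and without boundary.) For a $C^1$-function $f$ on $X$ let $\xi_f$ be its Hamiltonian vector field, $\omega(\xi_f,\cdot)=df$, and put $\{f,g\}=dg(\xi_f)=\omega(\xi_g,\xi_f)$;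 use the same conventions on $(Y,\omega_Y)$. Then $\omega_Y$ is nondegenerate (so that these notions make sense on $Y$), and for all $G$-invariant $C^1$-functions $f,g:X\to\mathbf R$ the induced functions $f',g':Y\to\mathbf R$, defined by $f'\circ\rho=f|_{\Phi^{-1}(0)}$ and $g'\circ\rho=g|_{\Phi^{-1}(0)}$, are $C^1$ and satisfy $$\{f',g'\}\circ\rho=\{f,g\}|_{\Phi^{-1}(0)}.$$ In particular, if $\{f,g\}=0$ on $X$, then $\{f',g'\}=0$ on $Y$. -/

import Mathlib

open scoped Manifold ContDiff

noncomputable section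

/-! ### Two-forms, Hamiltonian vector fields and Poisson brackets -/

section Symplectic

variable {E : Type*} [NormedAddCommGroup E] [NormedSpace ℝ E]
  {M : Type*} [TopologicalSpace M] [ChartedSpace E M]

/-- A (not necessarily smooth) differential two-form on a manifold `M` without boundary, modelled
on `E`: an alternating bilinear form on every tangent space. -/
abbrev TwoForm (E : Type*) [NormedAddCommGroup E] [NormedSpace ℝ E]
    (M : Type*) [TopologicalSpace M] [ChartedSpace E M] : Type _ :=
  ∀ x : M, TangentSpace 𝓘(ℝ, E) x [⋀^Fin 2]→L[ℝ] ℝ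

/-- The coordinate expression of `σ` in the chart `e`: the pullback of `σ` by `e.symm`. It is only
meaningful on `e.target`. -/
def TwoForm.inChart (σ : TwoForm E M) (e : OpenPartialHomeomorph M E) (y : E) :
    E [⋀^Fin 2]→L[ℝ] ℝ :=
  (σ (e.symm y)).compContinuousLinearMap (mfderiv 𝓘(ℝ, E) 𝓘(ℝ, E) e.symm y)

/-- `σ` is nondegenerate at every point. -/
def TwoForm.Nondegenerate (σ : TwoForm E M) : Prop :=
  ∀ (x : M) (u : TangentSpace 𝓘(ℝ, E) x),
    (∀ v : TangentSpace 𝓘(ℝ, E) x, σ x ![u, v] = 0) → u = 0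

/-- A symplectic form: a smooth, closed, nondegenerate two-form. Smoothness and closedness are
read in the charts of the atlas. -/
structure TwoForm.IsSymplectic (σ : TwoForm E M) : Prop where
  smooth : ∀ e ∈ atlas E M, ContDiffOn ℝ ∞ (σ.inChart e) e.target
  closed : ∀ e ∈ atlas E M, ∀ y ∈ e.target, extDeriv (σ.inChart e) y = 0
  nondegenerate : σ.Nondegenerate

/-- The differential of a real function at a point, as a real-valued linear map. -/
def differential (f : M → ℝ) (x : M) (v : TangentSpace 𝓘(ℝ, E) x) : ℝ :=
  mfderiv 𝓘(ℝ, E) 𝓘(ℝ, ℝ) f x v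

open Classical in
/-- The Hamiltonian vector field `ξ_f` of a function `f`, given by `σ(ξ_f, ·) = df`
(it exists and is unique if `σ` is nondegenerate and `E` is finite-dimensional). -/
def TwoForm.hamiltonianVectorField (σ : TwoForm E M) (f : M → ℝ) (x : M) :
    TangentSpace 𝓘(ℝ, E) x :=
  if h : ∃ u : TangentSpace 𝓘(ℝ, E) x,
      ∀ v : TangentSpace 𝓘(ℝ, E) x, σ x ![u, v] = differential f x v
  then h.choose else 0

/-- The Poisson bracket `{f, g} = dg(ξ_f) = σ(ξ_g, ξ_f)`. The sign is the one for which
`ξ_{f,g} = [ξ_f, ξ_g]`. -/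
def TwoForm.poissonBracket (σ : TwoForm E M) (f g : M → ℝ) (x : M) : ℝ :=
  differential g x (σ.hamiltonianVectorField f x)

end Symplectic

/-! ### Hamiltonian actions and the reduced space -/

section Hamiltonian

variable {EG : Type*} [NormedAddCommGroup EG] [NormedSpace ℝ EG]
  {G : Type*} [TopologicalSpace G] [ChartedSpace EG G] [Group G]
  {EX : Type*} [NormedAddCommGroup EX] [NormedSpace ℝ EX]
  {X : Type*} [TopologicalSpace X] [ChartedSpace EX X] [MulAction G X]

/-- The adjoint action of `a : G` on the Lie algebra: the differential at `1` of conjugation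
by `a`. -/
def adjointAction (a : G) (ξ : GroupLieAlgebra 𝓘(ℝ, EG) G) : GroupLieAlgebra 𝓘(ℝ, EG) G :=
  mfderiv 𝓘(ℝ, EG) 𝓘(ℝ, EG) (fun b : G => a * b * a⁻¹) 1 ξ

/-- The fundamental vector field of `ξ` in the Lie algebra: its value at `x` is the image of `ξ`
under the differential at `1` of the orbit map `a ↦ a • x`. -/
def fundamentalVectorField (ξ : GroupLieAlgebra 𝓘(ℝ, EG) G) (x : X) :
    TangentSpace 𝓘(ℝ, EX) x :=
  mfderiv 𝓘(ℝ, EG) 𝓘(ℝ, EX) (fun a : G => a • x) 1 ξ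

/-- The (already smooth) action of `G` on `(X, σ)` is Hamiltonian with moment map `Φ`: it preserves
`σ`, the components `Φ^ξ = ⟨Φ, ξ⟩` are smooth with `dΦ^ξ = σ(ξ_X, ·)`, and `Φ` is equivariant for
the coadjoint action. -/
structure IsHamiltonianAction (σ : TwoForm EX X)
    (Φ : X → Module.Dual ℝ (GroupLieAlgebra 𝓘(ℝ, EG) G)) : Prop where
  invariant : ∀ (a : G) (x : X) (u v : TangentSpace 𝓘(ℝ, EX) x),
    σ (a • x) ![mfderiv 𝓘(ℝ, EX) 𝓘(ℝ, EX) (fun y : X => a • y) x u,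
      mfderiv 𝓘(ℝ, EX) 𝓘(ℝ, EX) (fun y : X => a • y) x v] = σ x ![u, v]
  smooth : ∀ ξ, ContMDiff 𝓘(ℝ, EX) 𝓘(ℝ, ℝ) ∞ (fun x => Φ x ξ)
  moment : ∀ (ξ : GroupLieAlgebra 𝓘(ℝ, EG) G) (x : X) (v : TangentSpace 𝓘(ℝ, EX) x),
    differential (fun y => Φ y ξ) x v = σ x ![fundamentalVectorField ξ x, v]
  equivariant : ∀ (a : G) (x : X) (ξ : GroupLieAlgebra 𝓘(ℝ, EG) G),
    Φ (a • x) ξ = Φ x (adjointAction a⁻¹ ξ)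

/-- The zero level `Φ⁻¹(0)`, with the subspace topology. -/
abbrev ZeroLevel (Φ : X → Module.Dual ℝ (GroupLieAlgebra 𝓘(ℝ, EG) G)) : Type _ :=
  {x : X // Φ x = 0}

/-- Two points of `Φ⁻¹(0)` are equivalent if they lie on the same `G`-orbit. -/
abbrev reducedSetoid (Φ : X → Module.Dual ℝ (GroupLieAlgebra 𝓘(ℝ, EG) G)) :
    Setoid (ZeroLevel Φ) :=
  (MulAction.orbitRel G X).comap Subtype.val

/-- The reduced space `Y = Φ⁻¹(0) / G`, with the quotient topology. -/
abbrev ReducedSpace (Φ : X → Module.Dual ℝ (GroupLieAlgebra 𝓘(ℝ, EG) G)) : Type _ :=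
  Quotient (reducedSetoid Φ)

/-- The projection `ρ : Φ⁻¹(0) → Y`. -/
def reducedProj (Φ : X → Module.Dual ℝ (GroupLieAlgebra 𝓘(ℝ, EG) G)) (z : ZeroLevel Φ) :
    ReducedSpace Φ :=
  Quotient.mk (reducedSetoid Φ) z

/-- The function `f'` on `Y` induced by a `G`-invariant function `f` on `X`: `f' (ρ z) = f z`. -/
def inducedFunction (Φ : X → Module.Dual ℝ (GroupLieAlgebra 𝓘(ℝ, EG) G)) (f : X → ℝ)
    (hf : ∀ (a : G) (x : X), f (a • x) = f x) : ReducedSpace Φ → ℝ :=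
  Quotient.lift (fun z : ZeroLevel Φ => f z.1) (by
    rintro z w ⟨a, ha⟩
    have ha' : a • w.1 = z.1 := ha
    show f z.1 = f w.1
    rw [← ha', hf])

/-- `Φ` meets `0` cleanly: `Φ⁻¹(0)`, with the given manifold structure, is an embedded submanifold
of `X`, and its tangent space at every point `z` is the kernel of `dΦ_z` (where
`(dΦ_z u)(ξ) = dΦ^ξ_z(u)`). -/
structure MeetsZeroCleanly (EX : Type*) [NormedAddCommGroup EX] [NormedSpace ℝ EX]
    [ChartedSpace EX X] (EZ : Type*) [NormedAddCommGroup EZ] [NormedSpace ℝ EZ]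
    (Φ : X → Module.Dual ℝ (GroupLieAlgebra 𝓘(ℝ, EG) G)) [ChartedSpace EZ (ZeroLevel Φ)] :
    Prop where
  submanifold : Manifold.IsSmoothEmbedding 𝓘(ℝ, EZ) 𝓘(ℝ, EX) ∞ (Subtype.val : ZeroLevel Φ → X)
  tangent : ∀ (z : ZeroLevel Φ) (u : TangentSpace 𝓘(ℝ, EX) z.1),
    u ∈ Set.range (mfderiv 𝓘(ℝ, EZ) 𝓘(ℝ, EX) (Subtype.val : ZeroLevel Φ → X) z) ↔
      ∀ ξ : GroupLieAlgebra 𝓘(ℝ, EG) G, differential (fun y => Φ y ξ) z.1 u = 0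

/-- `σY` is the reduced two-form on `Y`: the pullback of `σY` by `ρ` is the restriction of `σ` to
`Φ⁻¹(0)`. As `ρ` is a surjective submersion, this determines `σY`. -/
def IsReducedForm (EZ : Type*) [NormedAddCommGroup EZ] [NormedSpace ℝ EZ]
    {EY : Type*} [NormedAddCommGroup EY] [NormedSpace ℝ EY]
    (Φ : X → Module.Dual ℝ (GroupLieAlgebra 𝓘(ℝ, EG) G)) [ChartedSpace EZ (ZeroLevel Φ)]
    [ChartedSpace EY (ReducedSpace Φ)] (σ : TwoForm EX X) (σY : TwoForm EY (ReducedSpace Φ)) :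
    Prop :=
  ∀ (z : ZeroLevel Φ) (u v : TangentSpace 𝓘(ℝ, EZ) z),
    σY (reducedProj Φ z) ![mfderiv 𝓘(ℝ, EZ) 𝓘(ℝ, EY) (reducedProj Φ) z u,
      mfderiv 𝓘(ℝ, EZ) 𝓘(ℝ, EY) (reducedProj Φ) z v] =
    σ z.1 ![mfderiv 𝓘(ℝ, EZ) 𝓘(ℝ, EX) (Subtype.val : ZeroLevel Φ → X) z u,
      mfderiv 𝓘(ℝ, EZ) 𝓘(ℝ, EX) (Subtype.val : ZeroLevel Φ → X) z v]

end Hamiltonian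

end

/-! Write `Z = Φ⁻¹(0)`. Since `dΦ^ξ = σ(ξ_X, ·)`, cleanness says that `T_z Z` is the `σ`-orthogonal
of the space `𝔤·z` of orbit directions (`MeetsZeroCleanly.mem_range_iff`); by finite dimension, the
orthogonal of `T_z Z` is then `𝔤·z`. A vector in the kernel of `ι^*σ` is therefore an orbit
direction, hence killed by `dρ`; as `dρ` is surjective, `σY` is nondegenerate.

If `f` is invariant, then `σ(ξ_X, ξ_f) = -df(ξ_X) = 0`, so `ξ_f` is tangent to `Z`. Its image under
`dρ` satisfies the equation that characterizes `ξ_{f'}`, because `ρ^*σY = ι^*σ` and `f' ∘ ρ = f ∘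
ι`. Applying `dg' ∘ dρ = dg ∘ dι` to it gives the bracket identity. Local sections of `ρ` supply the
regularity of `f'` and the surjectivity of `dρ`. -/

open scoped Manifold ContDiff Topology

/-! ### Local sections of submersions and local retractions of immersions -/

section LocalForms

variable {E : Type*} [NormedAddCommGroup E] [NormedSpace ℝ E]
  {E' : Type*} [NormedAddCommGroup E'] [NormedSpace ℝ E']
  {M : Type*} [TopologicalSpace M] [ChartedSpace E M]
  {N : Type*} [TopologicalSpace N] [ChartedSpace E' N]

/-- A submersion has a smooth local section through every point of its domain. -/
theorem Manifold.IsSubmersionAt.exists_local_section {f : M → N} {x : M}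
    (hf : Manifold.IsSubmersionAt 𝓘(ℝ, E) 𝓘(ℝ, E') ∞ f x) :
    ∃ s : N → M, s (f x) = x ∧ ContMDiffAt 𝓘(ℝ, E') 𝓘(ℝ, E) ∞ s (f x) ∧
      ∀ᶠ y in 𝓝 (f x), f (s y) = y := by
  -- In adapted charts `f` is the projection to the first factor; the section freezes the second
  -- coordinate at its value for `x`.
  let t : N → E := fun y => hf.equiv.symm (hf.codChart y, (hf.equiv (hf.domChart x)).2)
  have hx := hf.mem_domChart_source
  have hfx := hf.mem_codChart_source
  have key : ∀ u ∈ hf.domChart.target, hf.codChart (f (hf.domChart.symm u)) = (hf.equiv u).1 := by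
    intro u hu
    have hu' : u ∈ (hf.domChart.extend 𝓘(ℝ, E)).target := by simpa only [mfld_simps] using hu
    have h := hf.writtenInCharts hu'
    simpa using h
  have htx : t (f x) = hf.domChart x := by
    have h := key (hf.domChart x) (hf.domChart.map_source hx)
    rw [hf.domChart.left_inv hx] at h
    simp only [t, h]
    exact hf.equiv.symm_apply_apply _
  have hcod : ContMDiffAt 𝓘(ℝ, E') 𝓘(ℝ, E') ∞ hf.codChart (f x) :=
    contMDiffAt_of_mem_maximalAtlas hf.codChart_mem_maximalAtlas hfx
  have ht : ContMDiffAt 𝓘(ℝ, E') 𝓘(ℝ, E) ∞ t (f x) :=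
    hf.equiv.symm.contDiff.contMDiff.contMDiffAt.comp _ (hcod.prodMk_space contMDiffAt_const)
  have htarget : ∀ᶠ y in 𝓝 (f x), t y ∈ hf.domChart.target :=
    ht.continuousAt.eventually (hf.domChart.open_target.mem_nhds
      (by rw [htx]; exact hf.domChart.map_source hx))
  refine ⟨hf.domChart.symm ∘ t, ?_, ?_, ?_⟩
  · simp [htx, hf.domChart.left_inv hx]
  · refine ContMDiffAt.comp _ ?_ ht
    rw [htx]
    exact contMDiffAt_symm_of_mem_maximalAtlas hf.domChart_mem_maximalAtlas
      (hf.domChart.map_source hx)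
  · filter_upwards [htarget, hf.codChart.open_source.mem_nhds hfx] with y hy hy'
    have h := key (t y) hy
    have hmem : f (hf.domChart.symm (t y)) ∈ hf.codChart.source :=
      hf.source_subset_preimage_source (hf.domChart.map_target hy)
    apply hf.codChart.injOn hmem hy'
    simpa [t] using h

/-- An immersion has a smooth local retraction near every point of its domain. -/
theorem Manifold.IsImmersionAt.exists_local_retraction {f : M → N} {x : M}
    (hf : Manifold.IsImmersionAt 𝓘(ℝ, E) 𝓘(ℝ, E') ∞ f x) :
    ∃ r : N → M, ContMDiffAt 𝓘(ℝ, E') 𝓘(ℝ, E) ∞ r (f x) ∧ ∀ᶠ y in 𝓝 x, r (f y) = y := by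
  -- In adapted charts `f` is `u ↦ (u, 0)`; the retraction forgets the second coordinate.
  let t : N → E := fun y => (hf.equiv.symm (hf.codChart y)).1
  have hx := hf.mem_domChart_source
  have hfx := hf.mem_codChart_source
  have key : ∀ y ∈ hf.domChart.source, t (f y) = hf.domChart y := by
    intro y hy
    have hy' : hf.domChart y ∈ (hf.domChart.extend 𝓘(ℝ, E)).target := by
      simpa only [mfld_simps] using hf.domChart.map_source hy
    have h := hf.writtenInCharts hy'
    simp only [mfld_simps, Function.comp_apply,
      hf.domChart.left_inv hy] at h
    simp only [t, h]
    simp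
  have hcod : ContMDiffAt 𝓘(ℝ, E') 𝓘(ℝ, E') ∞ hf.codChart (f x) :=
    contMDiffAt_of_mem_maximalAtlas hf.codChart_mem_maximalAtlas hfx
  have ht : ContMDiffAt 𝓘(ℝ, E') 𝓘(ℝ, E) ∞ t (f x) :=
    (contDiff_fst.comp hf.equiv.symm.contDiff).contMDiff.contMDiffAt.comp _ hcod
  refine ⟨hf.domChart.symm ∘ t, ?_, ?_⟩
  · refine ContMDiffAt.comp _ ?_ ht
    rw [key x hx]
    exact contMDiffAt_symm_of_mem_maximalAtlas hf.domChart_mem_maximalAtlas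
      (hf.domChart.map_source hx)
  · filter_upwards [hf.domChart.open_source.mem_nhds hx] with y hy
    simp [key y hy, hf.domChart.left_inv hy]

/-- The differential of a submersion is surjective. -/
theorem Manifold.IsSubmersionAt.mfderiv_surjective {f : M → N} {x : M}
    (hf : Manifold.IsSubmersionAt 𝓘(ℝ, E) 𝓘(ℝ, E') ∞ f x) :
    Function.Surjective (mfderiv 𝓘(ℝ, E) 𝓘(ℝ, E') f x) := by
  obtain ⟨s, hsx, hs, hfs⟩ := hf.exists_local_section
  intro v
  have hf' : MDifferentiableAt 𝓘(ℝ, E) 𝓘(ℝ, E') f (s (f x)) := by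
    rw [hsx]; exact hf.contMDiffAt.mdifferentiableAt (by simp)
  have hcomp := mfderiv_comp (f x) hf' (hs.mdifferentiableAt (by simp))
  have hid : mfderiv 𝓘(ℝ, E') 𝓘(ℝ, E') (f ∘ s) (f x) = mfderiv 𝓘(ℝ, E') 𝓘(ℝ, E') id (f x) :=
    Filter.EventuallyEq.mfderiv_eq hfs
  rw [hcomp, mfderiv_id, hsx] at hid
  exact ⟨mfderiv 𝓘(ℝ, E') 𝓘(ℝ, E) s (f x) v, DFunLike.congr_fun hid v⟩

/-- Functions descend along surjective submersions with their regularity. -/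
theorem Manifold.IsSubmersion.contMDiff_of_comp {f : M → N}
    (hf : Manifold.IsSubmersion 𝓘(ℝ, E) 𝓘(ℝ, E') ∞ f) (hsurj : Function.Surjective f)
    {h : N → ℝ} (hh : ContMDiff 𝓘(ℝ, E) 𝓘(ℝ, ℝ) 1 (h ∘ f)) :
    ContMDiff 𝓘(ℝ, E') 𝓘(ℝ, ℝ) 1 h := by
  intro y
  obtain ⟨x, rfl⟩ := hsurj y
  obtain ⟨s, -, hs, hfs⟩ := (hf.isSubmersionAt x).exists_local_section
  have hcomp : ContMDiffAt 𝓘(ℝ, E') 𝓘(ℝ, ℝ) 1 ((h ∘ f) ∘ s) (f x) :=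
    (hh (s (f x))).comp _ (hs.of_le (by simp))
  refine hcomp.congr_of_eventuallyEq ?_
  filter_upwards [hfs] with y hy
  simp [hy]

end LocalForms

/-! ### Linear algebra of two-forms and Hamiltonian vector fields -/

section Symplectic

theorem Matrix.update_pair_fst {α : Type*} (a b c : α) :
    Function.update ![a, b] 0 c = ![c, b] := by
  ext i; fin_cases i <;> rfl

theorem Matrix.update_pair_snd {α : Type*} (a b c : α) :
    Function.update ![a, b] 1 c = ![a, c] := by
  ext i; fin_cases i <;> rfl

variable {E : Type*} [NormedAddCommGroup E] [NormedSpace ℝ E]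
  {M : Type*} [TopologicalSpace M] [ChartedSpace E M]

theorem TwoForm.swap (σ : TwoForm E M) (x : M) (u v : TangentSpace 𝓘(ℝ, E) x) :
    σ x ![u, v] = -σ x ![v, u] := by
  have h := (σ x).toAlternatingMap.map_swap ![v, u] (i := 0) (j := 1) (by decide)
  have h' : (![v, u] ∘ Equiv.swap (0 : Fin 2) 1 : Fin 2 → TangentSpace 𝓘(ℝ, E) x) = ![u, v] := by
    ext i; fin_cases i <;> simp
  rw [h'] at h
  exact h

/-- The bilinear form on a tangent space given by a two-form. -/
noncomputable def TwoForm.bilin (σ : TwoForm E M) (x : M) : LinearMap.BilinForm ℝ (TangentSpace 𝓘(ℝ, E) x) :=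
  LinearMap.mk₂ ℝ (fun u v => σ x ![u, v])
    (fun u u' v => by
      have h := (σ x).toAlternatingMap.map_update_add ![u, v] 0 u u'
      simp only [Matrix.update_pair_fst] at h
      exact h)
    (fun c u v => by
      have h := (σ x).toAlternatingMap.map_update_smul ![u, v] 0 c u
      simp only [Matrix.update_pair_fst] at h
      exact h)
    (fun u v v' => by
      have h := (σ x).toAlternatingMap.map_update_add ![u, v] 1 v v'
      simp only [Matrix.update_pair_snd] at h
      exact h)
    (fun c u v => by
      have h := (σ x).toAlternatingMap.map_update_smul ![u, v] 1 c v
      simp only [Matrix.update_pair_snd] at h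
      exact h)

@[simp]
theorem TwoForm.bilin_apply (σ : TwoForm E M) (x : M) (u v : TangentSpace 𝓘(ℝ, E) x) :
    σ.bilin x u v = σ x ![u, v] := rfl

theorem TwoForm.bilin_isRefl (σ : TwoForm E M) (x : M) : (σ.bilin x).IsRefl := by
  intro u v h
  rw [TwoForm.bilin_apply] at h ⊢
  rw [σ.swap, h, neg_zero]

theorem TwoForm.Nondegenerate.bilin {σ : TwoForm E M} (hσ : σ.Nondegenerate) (x : M) :
    (σ.bilin x).Nondegenerate :=
  (σ.bilin_isRefl x).nondegenerate_iff_separatingLeft.2 fun u hu => hσ x u hu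

/-- In finite dimension `u ↦ σ(u, ·)` is an isomorphism onto the dual, so the default value `0` in
the definition is never taken for want of a solution. -/
theorem TwoForm.Nondegenerate.hamiltonianVectorField_apply [FiniteDimensional ℝ E]
    {σ : TwoForm E M} (hσ : σ.Nondegenerate) (f : M → ℝ) (x : M) (v : TangentSpace 𝓘(ℝ, E) x) :
    σ x ![σ.hamiltonianVectorField f x, v] = differential f x v := by
  have : FiniteDimensional ℝ (TangentSpace 𝓘(ℝ, E) x) := inferInstanceAs (FiniteDimensional ℝ E)
  have h : ∃ u : TangentSpace 𝓘(ℝ, E) x,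
      ∀ v : TangentSpace 𝓘(ℝ, E) x, σ x ![u, v] = differential f x v := by
    refine ⟨((σ.bilin x).toDual (hσ.bilin x)).symm
      (mfderiv 𝓘(ℝ, E) 𝓘(ℝ, ℝ) f x).toLinearMap, fun v => ?_⟩
    exact LinearMap.BilinForm.apply_toDual_symm_apply (B := σ.bilin x) (hB := hσ.bilin x) _ v
  rw [TwoForm.hamiltonianVectorField, dif_pos h]
  exact h.choose_spec v

theorem TwoForm.Nondegenerate.eq_hamiltonianVectorField [FiniteDimensional ℝ E]
    {σ : TwoForm E M} (hσ : σ.Nondegenerate) {f : M → ℝ} {x : M} {u : TangentSpace 𝓘(ℝ, E) x}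
    (hu : ∀ v, σ x ![u, v] = differential f x v) : u = σ.hamiltonianVectorField f x := by
  rw [← sub_eq_zero]
  refine hσ x _ fun v => ?_
  rw [← TwoForm.bilin_apply, map_sub, LinearMap.sub_apply, TwoForm.bilin_apply,
    TwoForm.bilin_apply, hu, hσ.hamiltonianVectorField_apply, sub_self]

end Symplectic

/-! ### Orbit directions and the tangent space of the zero level -/

section Hamiltonian

variable {EX : Type*} [NormedAddCommGroup EX] [NormedSpace ℝ EX]
  {X : Type*} [TopologicalSpace X] [ChartedSpace EX X]
  {σ : TwoForm EX X}
  {EG : Type*} [NormedAddCommGroup EG] [NormedSpace ℝ EG]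
  {G : Type*} [TopologicalSpace G] [ChartedSpace EG G] [Group G]
  [MulAction G X]
  {Φ : X → Module.Dual ℝ (GroupLieAlgebra 𝓘(ℝ, EG) G)}
  {EZ : Type*} [NormedAddCommGroup EZ] [NormedSpace ℝ EZ] [ChartedSpace EZ (ZeroLevel Φ)]
  {EY : Type*} [NormedAddCommGroup EY] [NormedSpace ℝ EY] [ChartedSpace EY (ReducedSpace Φ)]

theorem IsHamiltonianAction.smul_mem_zeroLevel (hΦ : IsHamiltonianAction σ Φ) (a : G)
    (z : ZeroLevel Φ) : Φ (a • z.1) = 0 := by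
  ext ξ
  rw [hΦ.equivariant, z.2, LinearMap.zero_apply, LinearMap.zero_apply]

omit [TopologicalSpace X] in
theorem reducedProj_surjective : Function.Surjective (reducedProj Φ) := Quotient.mk_surjective

omit [TopologicalSpace X] in
theorem reducedProj_smul (a : G) (z : ZeroLevel Φ) (h : Φ (a • z.1) = 0) :
    reducedProj Φ ⟨a • z.1, h⟩ = reducedProj Φ z :=
  Quotient.sound ⟨a, rfl⟩

/-- An invariant function is annihilated by the fundamental vector fields. -/
theorem differential_fundamentalVectorField [IsManifold 𝓘(ℝ, EX) ∞ X]
    [ContMDiffSMul 𝓘(ℝ, EG) 𝓘(ℝ, EX) ∞ G X] {f : X → ℝ}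
    (hfs : ContMDiff 𝓘(ℝ, EX) 𝓘(ℝ, ℝ) 1 f) (hf : ∀ (a : G) (x : X), f (a • x) = f x)
    (ξ : GroupLieAlgebra 𝓘(ℝ, EG) G) (x : X) :
    differential (E := EX) f x (fundamentalVectorField ξ x) = 0 := by
  have horb : ContMDiff 𝓘(ℝ, EG) 𝓘(ℝ, EX) ∞ (fun a : G => a • x) :=
    contMDiff_id.smul contMDiff_const
  have hcomp := mfderiv_comp (1 : G) (g := f) (f := fun a : G => a • x)
    ((hfs _).mdifferentiableAt (by simp)) ((horb 1).mdifferentiableAt (by simp))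
  have hconst : f ∘ (fun a : G => a • x) = fun _ => f x := by
    ext a; exact hf a x
  rw [hconst, mfderiv_const, one_smul] at hcomp
  exact (DFunLike.congr_fun hcomp ξ).symm

/-- The tangent space of the zero level is the orthogonal of the tangent space of the
orbit. -/
theorem MeetsZeroCleanly.mem_range_iff (hclean : MeetsZeroCleanly EX EZ Φ)
    (hΦ : IsHamiltonianAction σ Φ) (z : ZeroLevel Φ) (u : TangentSpace 𝓘(ℝ, EX) z.1) :
    u ∈ Set.range (mfderiv 𝓘(ℝ, EZ) 𝓘(ℝ, EX) (Subtype.val : ZeroLevel Φ → X) z) ↔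
      ∀ ξ : GroupLieAlgebra 𝓘(ℝ, EG) G, σ z.1 ![fundamentalVectorField ξ z.1, u] = 0 := by
  simp only [hclean.tangent, hΦ.moment]

/-- A vector orthogonal to the tangent space of the zero level is tangent to the orbit. -/
theorem MeetsZeroCleanly.exists_fundamentalVectorField_eq [FiniteDimensional ℝ EX]
    (hclean : MeetsZeroCleanly EX EZ Φ) (hσ : σ.Nondegenerate)
    (hΦ : IsHamiltonianAction σ Φ) (z : ZeroLevel Φ) (u : TangentSpace 𝓘(ℝ, EX) z.1)
    (hu : ∀ v : TangentSpace 𝓘(ℝ, EZ) z,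
      σ z.1 ![u, mfderiv 𝓘(ℝ, EZ) 𝓘(ℝ, EX) (Subtype.val : ZeroLevel Φ → X) z v] = 0) :
    ∃ ξ : GroupLieAlgebra 𝓘(ℝ, EG) G, fundamentalVectorField ξ z.1 = u := by
  have : FiniteDimensional ℝ (TangentSpace 𝓘(ℝ, EX) z.1) :=
    inferInstanceAs (FiniteDimensional ℝ EX)
  let orb : GroupLieAlgebra 𝓘(ℝ, EG) G →ₗ[ℝ] TangentSpace 𝓘(ℝ, EX) ((1 : G) • z.1) :=
    (mfderiv 𝓘(ℝ, EG) 𝓘(ℝ, EX) (fun a : G => a • z.1) 1).toLinearMap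
  -- The tangent spaces at `1 • z` and at `z` are both `EX` by definition, so the map can be retyped
  -- without a transport.
  let orb' : GroupLieAlgebra 𝓘(ℝ, EG) G →ₗ[ℝ] TangentSpace 𝓘(ℝ, EX) z.1 := orb
  have hW := LinearMap.BilinForm.orthogonal_orthogonal (hσ.bilin z.1) (σ.bilin_isRefl z.1)
    (LinearMap.range orb')
  suffices h : u ∈ LinearMap.range orb' from h
  rw [← hW, LinearMap.BilinForm.mem_orthogonal_iff]
  intro v hv
  -- By the double orthogonal, it is enough to test `u` against vectors orthogonal to the orbit, and
  -- these are tangent to the zero level.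
  obtain ⟨w, rfl⟩ := (hclean.mem_range_iff hΦ z v).2 fun ξ =>
    (LinearMap.BilinForm.mem_orthogonal_iff.1 hv) (orb' ξ) ⟨ξ, rfl⟩
  exact σ.bilin_isRefl z.1 _ _ (hu w)

/-- Vectors tangent to the orbits are annihilated by the differential of the projection to the
reduced space. -/
theorem mfderiv_reducedProj_eq_zero [IsManifold 𝓘(ℝ, EX) ∞ X]
    [IsManifold 𝓘(ℝ, EZ) ∞ (ZeroLevel Φ)] [IsManifold 𝓘(ℝ, EY) ∞ (ReducedSpace Φ)]
    [ContMDiffSMul 𝓘(ℝ, EG) 𝓘(ℝ, EX) ∞ G X]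
    (hclean : MeetsZeroCleanly EX EZ Φ) (hΦ : IsHamiltonianAction σ Φ)
    (hρ : ContMDiff 𝓘(ℝ, EZ) 𝓘(ℝ, EY) ∞ (reducedProj Φ)) (z : ZeroLevel Φ)
    (u : TangentSpace 𝓘(ℝ, EZ) z) (ξ : GroupLieAlgebra 𝓘(ℝ, EG) G)
    (hu : fundamentalVectorField ξ z.1 =
      mfderiv 𝓘(ℝ, EZ) 𝓘(ℝ, EX) (Subtype.val : ZeroLevel Φ → X) z u) :
    mfderiv 𝓘(ℝ, EZ) 𝓘(ℝ, EY) (reducedProj Φ) z u = 0 := by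
  -- `ρ ∘ r` is differentiable at `z` as a map on `X`, so the orbit map can be differentiated in
  -- `X`, with no need for its smoothness as a map into the zero level.
  obtain ⟨r, hr, hrι⟩ := (hclean.submanifold.isImmersion.isImmersionAt z).exists_local_retraction
  have horb : ContMDiff 𝓘(ℝ, EG) 𝓘(ℝ, EX) ∞ (fun a : G => a • z.1) :=
    contMDiff_id.smul contMDiff_const
  have hρr : MDifferentiableAt 𝓘(ℝ, EX) 𝓘(ℝ, EY) (reducedProj Φ ∘ r) z.1 :=
    ((hρ _).comp _ hr).mdifferentiableAt (by simp)
  have hρr' : MDifferentiableAt 𝓘(ℝ, EX) 𝓘(ℝ, EY) (reducedProj Φ ∘ r) ((1 : G) • z.1) := by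
    rwa [one_smul]
  have hι : MDifferentiableAt 𝓘(ℝ, EZ) 𝓘(ℝ, EX) (Subtype.val : ZeroLevel Φ → X) z :=
    (hclean.submanifold.contMDiff z).mdifferentiableAt (by simp)
  have h₁ := mfderiv_comp z hρr hι
  have h₂ := mfderiv_comp (1 : G) (f := fun a : G => a • z.1) hρr'
    ((horb 1).mdifferentiableAt (by simp))
  have e₁ : (reducedProj Φ ∘ r) ∘ Subtype.val =ᶠ[𝓝 z] reducedProj Φ := by
    filter_upwards [hrι] with w hw
    simp [hw]
  -- Continuity into the zero level suffices: for `a` near `1`, the point `a • z` stays where `r ∘ ι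
  -- = id`, so `ρ ∘ r` is constant along the orbit there.
  have hc : Continuous (fun a : G => (⟨a • z.1, hΦ.smul_mem_zeroLevel a z⟩ : ZeroLevel Φ)) :=
    horb.continuous.subtype_mk _
  have hc1 : (⟨(1 : G) • z.1, hΦ.smul_mem_zeroLevel 1 z⟩ : ZeroLevel Φ) = z :=
    Subtype.ext (one_smul _ _)
  have e₂ : (reducedProj Φ ∘ r) ∘ (fun a : G => a • z.1) =ᶠ[𝓝 1] fun _ => reducedProj Φ z := by
    have ht := hc.tendsto 1
    rw [hc1] at ht
    filter_upwards [ht.eventually hrι] with a ha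
    simp only [Function.comp_apply, ha]
    exact reducedProj_smul a z _
  rw [e₁.mfderiv_eq] at h₁
  rw [e₂.mfderiv_eq, mfderiv_const, one_smul] at h₂
  have h₁u := DFunLike.congr_fun h₁ u
  have h₂ξ := DFunLike.congr_fun h₂ ξ
  exact h₁u.trans ((congrArg (mfderiv 𝓘(ℝ, EX) 𝓘(ℝ, EY) (reducedProj Φ ∘ r) z.1) hu.symm).trans
    h₂ξ.symm)

end Hamiltonian

/-! ### The reduction theorem -/

theorem lemma3p4
    -- the symplectic manifold `X`
    {EX : Type*} [NormedAddCommGroup EX] [NormedSpace ℝ EX] [FiniteDimensional ℝ EX]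
    {X : Type*} [TopologicalSpace X] [ChartedSpace EX X] [IsManifold 𝓘(ℝ, EX) ∞ X]
    (σ : TwoForm EX X) (hσ : σ.IsSymplectic)
    -- the Lie group `G`, acting smoothly on `X`
    {EG : Type*} [NormedAddCommGroup EG] [NormedSpace ℝ EG] [FiniteDimensional ℝ EG]
    {G : Type*} [TopologicalSpace G] [ChartedSpace EG G] [Group G] [LieGroup 𝓘(ℝ, EG) ∞ G]
    [MulAction G X] [ContMDiffSMul 𝓘(ℝ, EG) 𝓘(ℝ, EX) ∞ G X]
    -- the moment map
    (Φ : X → Module.Dual ℝ (GroupLieAlgebra 𝓘(ℝ, EG) G)) (hΦ : IsHamiltonianAction σ Φ)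
    -- the submanifold `Φ⁻¹(0)`
    {EZ : Type*} [NormedAddCommGroup EZ] [NormedSpace ℝ EZ] [FiniteDimensional ℝ EZ]
    [ChartedSpace EZ (ZeroLevel Φ)] [IsManifold 𝓘(ℝ, EZ) ∞ (ZeroLevel Φ)]
    (hclean : MeetsZeroCleanly EX EZ Φ)
    -- the quotient manifold `Y = Φ⁻¹(0) / G` and its reduced form
    {EY : Type*} [NormedAddCommGroup EY] [NormedSpace ℝ EY] [FiniteDimensional ℝ EY]
    [ChartedSpace EY (ReducedSpace Φ)] [IsManifold 𝓘(ℝ, EY) ∞ (ReducedSpace Φ)]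
    (hρ : Manifold.IsSubmersion 𝓘(ℝ, EZ) 𝓘(ℝ, EY) ∞ (reducedProj Φ))
    (σY : TwoForm EY (ReducedSpace Φ)) (hσY : IsReducedForm EZ Φ σ σY) :
    σY.Nondegenerate ∧
    ∀ (f g : X → ℝ) (_ : ContMDiff 𝓘(ℝ, EX) 𝓘(ℝ, ℝ) 1 f) (_ : ContMDiff 𝓘(ℝ, EX) 𝓘(ℝ, ℝ) 1 g)
      (hf : ∀ (a : G) (x : X), f (a • x) = f x) (hg : ∀ (a : G) (x : X), g (a • x) = g x),
      ContMDiff 𝓘(ℝ, EY) 𝓘(ℝ, ℝ) 1 (inducedFunction Φ f hf) ∧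
      ContMDiff 𝓘(ℝ, EY) 𝓘(ℝ, ℝ) 1 (inducedFunction Φ g hg) ∧
      (∀ z : ZeroLevel Φ,
        σY.poissonBracket (inducedFunction Φ f hf) (inducedFunction Φ g hg) (reducedProj Φ z) =
          σ.poissonBracket f g z.1) ∧
      ((∀ x : X, σ.poissonBracket f g x = 0) →
        ∀ y : ReducedSpace Φ,
          σY.poissonBracket (inducedFunction Φ f hf) (inducedFunction Φ g hg) y = 0) := by
  have hnd := hσ.nondegenerate
  have hρs : ∀ z, Function.Surjective (mfderiv 𝓘(ℝ, EZ) 𝓘(ℝ, EY) (reducedProj Φ) z) :=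
    fun z => (hρ.isSubmersionAt z).mfderiv_surjective
  have hnY : σY.Nondegenerate := by
    intro y u hu
    obtain ⟨z, rfl⟩ := reducedProj_surjective y
    obtain ⟨w, rfl⟩ := hρs z u
    obtain ⟨ξ, hξ⟩ := hclean.exists_fundamentalVectorField_eq hnd hΦ z
      (mfderiv 𝓘(ℝ, EZ) 𝓘(ℝ, EX) (Subtype.val : ZeroLevel Φ → X) z w)
      (fun v => by rw [← hσY z w v]; exact hu _)
    exact mfderiv_reducedProj_eq_zero hclean hΦ hρ.contMDiff z w ξ hξ
  have hsmooth : ∀ (f : X → ℝ) (_ : ContMDiff 𝓘(ℝ, EX) 𝓘(ℝ, ℝ) 1 f)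
      (hf : ∀ (a : G) (x : X), f (a • x) = f x),
      ContMDiff 𝓘(ℝ, EY) 𝓘(ℝ, ℝ) 1 (inducedFunction Φ f hf) := fun f hfs hf =>
    -- `f' ∘ ρ = f ∘ ι` holds by definition of the quotient lift; `hdiff` below relies on this too.
    hρ.contMDiff_of_comp reducedProj_surjective
      (hfs.comp (hclean.submanifold.contMDiff.of_le (by simp)))
  refine ⟨hnY, fun f g hfs hgs hf hg => ?_⟩
  have hdiff : ∀ (h : X → ℝ) (_ : ContMDiff 𝓘(ℝ, EX) 𝓘(ℝ, ℝ) 1 h)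
      (hh : ∀ (a : G) (x : X), h (a • x) = h x) (z : ZeroLevel Φ) (v : TangentSpace 𝓘(ℝ, EZ) z),
      differential (inducedFunction Φ h hh) (reducedProj Φ z)
        (mfderiv 𝓘(ℝ, EZ) 𝓘(ℝ, EY) (reducedProj Φ) z v) =
      differential h z.1 (mfderiv 𝓘(ℝ, EZ) 𝓘(ℝ, EX) (Subtype.val : ZeroLevel Φ → X) z v) := by
    intro h hs hh z v
    have h₁ := mfderiv_comp z (((hsmooth h hs hh) (reducedProj Φ z)).mdifferentiableAt (by simp))
      ((hρ.contMDiff z).mdifferentiableAt (by simp))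
    have h₂ := mfderiv_comp z ((hs z.1).mdifferentiableAt (by simp))
      ((hclean.submanifold.contMDiff z).mdifferentiableAt (by simp))
    exact DFunLike.congr_fun (h₁.symm.trans h₂) v
  have hbracket : ∀ z : ZeroLevel Φ,
      σY.poissonBracket (inducedFunction Φ f hf) (inducedFunction Φ g hg) (reducedProj Φ z) =
        σ.poissonBracket f g z.1 := by
    intro z
    -- Invariance of `f` makes `ξ_f` orthogonal to the orbit, so it lifts to a tangent vector `w` of
    -- the zero level.
    obtain ⟨w, hw⟩ := (hclean.mem_range_iff hΦ z (σ.hamiltonianVectorField f z.1)).2 fun ξ => by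
      rw [σ.swap, hnd.hamiltonianVectorField_apply, differential_fundamentalVectorField hfs hf,
        neg_zero]
    have hham : mfderiv 𝓘(ℝ, EZ) 𝓘(ℝ, EY) (reducedProj Φ) z w =
        σY.hamiltonianVectorField (inducedFunction Φ f hf) (reducedProj Φ z) := by
      refine hnY.eq_hamiltonianVectorField fun v => ?_
      -- Testing on vectors `dρ(v)` is enough, and there both sides pull back to the equation
      -- `σ(ξ_f, ·) = df` along the zero level.
      obtain ⟨v, rfl⟩ := hρs z v
      rw [hσY, hw, hnd.hamiltonianVectorField_apply, hdiff f hfs hf]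
    rw [TwoForm.poissonBracket, TwoForm.poissonBracket, ← hham, hdiff g hgs hg, hw]
  refine ⟨hsmooth f hfs hf, hsmooth g hgs hg, hbracket, fun h y => ?_⟩
  obtain ⟨z, rfl⟩ := reducedProj_surjective y
  rw [hbracket, h]
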